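/- Let $q\ge 2$ be an integer and let $s_q(n)$ denote the sum of the digits of the standard $q$-ary expansion of the integer $n\ge 0$. There is exactly one continuous $1$-periodic function $\Psi_1:\mathbb R\to\mathbb R$ such that $$\Psi_1(\log_q N)=\frac1N\sum_{0\le n<N}s_q(n)-\frac{q-1}{2}\log_q N$$ for all integers $N\ge 1$. Its Fourier coefficients $c_k=\int_0^1\Psi_1(x)e^{-2\pi i k x}\,dx$, $k\in\mathbb Z$, are $$c_0=\frac{q-1}{2\log q}\bigl(\log(2\pi)-1\bigr)-\frac{q+1}{4},\qquad c_k=-\frac{q-1}{\chi_k(1+\chi_k)\log q}\,\zeta(\chi_k)\quad\text{for } k\neq 0,$$ where $\chi_k=\frac{2\pi i k}{\log q}$ and $\zeta$ denotes the Riemann zeta function. -/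

import Mathlib

/-- The `q`-ary sum-of-digits function `s_q(n)`. -/
def sumOfDigits (q n : ℕ) : ℕ := (Nat.digits q n).sum

/-- `Ψ` is the periodic fluctuation of the `q`-ary sum of digits: a continuous, `1`-periodic
function on the real line whose value at `log_q N` is
`(1/N) ∑_{n<N} s_q(n) - ((q-1)/2) log_q N`, for every positive integer `N`. -/
structure IsDigitFluctuation (q : ℕ) (Ψ : ℝ → ℝ) : Prop where
  continuous : Continuous Ψ
  periodic : Function.Periodic Ψ 1
  value : ∀ N : ℕ, 1 ≤ N →
    Ψ (Real.logb q N) =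
      (1 / (N : ℝ)) * ∑ n ∈ Finset.range N, (sumOfDigits q n : ℝ)
        - (((q : ℝ) - 1) / 2) * Real.logb q N

/-- The points `χ_k = 2πik / log q`. -/
noncomputable def chi (q : ℕ) (k : ℤ) : ℂ :=
  2 * (Real.pi : ℂ) * Complex.I * (k : ℂ) / (Real.log q : ℂ)

/-! By Legendre's formula, s_q(n) = n - (q-1) ∑_j ⌊n/q^j⌋, and summing ⌊n/m⌋ over n < N leaves the
error m G(N/m), with G = `sawtoothPrimitive` (`sum_sumOfDigits`). Let x be the fractional part of
log_q N and g(y) = G(q^y)/q^y. The errors divided by N are the first terms of ∑_r g(x+r); the later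
ones vanish because G is zero at integers. So the fluctuation is (q^x - 1 - (q-1)x)/2 - (q-1) ∑_r
g(x+r) on [0,1]. It vanishes at both ends, hence extends periodically. Uniqueness holds since the
numbers log_q N are dense modulo 1.

For the Fourier coefficients, periodicity of the exponential unfolds the series into an integral
over [0,∞), and v = q^y turns it into M(χ_k)/log q, where M(s) = ∫_1^∞ G(v) v^(-2-s) dv. Integration
by parts and analytic continuation give M(s) = ζ(s)/(s(s+1)) + 1/(2s(1-s)) for re s > -1, apart from
s = 0, 1 (`sawtoothMellin_eq_riemannZeta`). The rational term cancels the contribution of the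
elementary part of the profile. At k = 0 the value M(0) comes from ζ(0) and ζ'(0). -/

/-- The `1`-periodic continuous function equal to `x * (1 - x) / 2` on `[0, 1]`; it is the primitive
of the sawtooth `1/2 - fract x` vanishing at the integers. -/
noncomputable def sawtoothPrimitive (x : ℝ) : ℝ := Int.fract x * (1 - Int.fract x) / 2

theorem continuous_sawtoothPrimitive : Continuous sawtoothPrimitive := by
  have h : ContinuousOn (fun x : ℝ => x * (1 - x) / 2) (Set.Icc 0 1) := by fun_prop
  exact h.comp_fract'' (by norm_num)

theorem sawtoothPrimitive_nonneg (x : ℝ) : 0 ≤ sawtoothPrimitive x := by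
  have h0 := Int.fract_nonneg x
  have h1 := (Int.fract_lt_one x).le
  unfold sawtoothPrimitive
  have := mul_nonneg h0 (sub_nonneg.2 h1)
  linarith

theorem sawtoothPrimitive_le_one (x : ℝ) : sawtoothPrimitive x ≤ 1 := by
  have h0 := Int.fract_nonneg x
  have h1 := (Int.fract_lt_one x).le
  unfold sawtoothPrimitive
  nlinarith

theorem sawtoothPrimitive_natCast (n : ℕ) : sawtoothPrimitive n = 0 := by
  simp [sawtoothPrimitive]

/-! ### Exact summation of the sum of digits -/

theorem sum_range_div_eq (m N : ℕ) (hm : 0 < m) :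
    ∑ n ∈ Finset.range N, ((n / m : ℕ) : ℝ) =
      (N : ℝ) ^ 2 / (2 * m) - N / 2 + m * sawtoothPrimitive (N / m) := by
  -- With N = a m + b, the values 0, ..., a-1 each occur m times and the value a occurs b times.
  have key : ∀ N : ℕ, 2 * ∑ n ∈ Finset.range N, ((n / m : ℕ) : ℝ) =
      ((N / m : ℕ) : ℝ) * (m * (((N / m : ℕ) : ℝ) - 1) + 2 * (N % m : ℕ)) := by
    intro N
    induction N with
    | zero => simp
    | succ N ih =>
      rw [Finset.sum_range_succ, mul_add, ih]
      have hd := Nat.div_add_mod N m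
      have hlt := Nat.mod_lt N hm
      by_cases h : N % m + 1 = m
      · have h1 : (N + 1) / m = N / m + 1 := by
          rw [Nat.div_eq_iff hm]
          constructor
          · nlinarith
          · have : (N / m + 1) * m = m * (N / m) + m := by ring
            omega
        have h2 : (N + 1) % m = 0 := by
          have := Nat.div_add_mod (N + 1) m
          rw [h1, mul_add] at this
          omega
        have h3 : ((N % m : ℕ) : ℝ) = m - 1 := by
          rw [eq_sub_iff_add_eq]; exact_mod_cast h
        rw [h1, h2, h3]
        push_cast
        ring
      · have hlt' : N % m + 1 < m := by omega
        have h1 : (N + 1) / m = N / m := by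
          rw [Nat.div_eq_iff hm]
          constructor
          · have : N / m * m = m * (N / m) := mul_comm _ _
            omega
          · have : N / m * m = m * (N / m) := mul_comm _ _
            omega
        have h2 : (N + 1) % m = N % m + 1 := by
          have := Nat.div_add_mod (N + 1) m
          rw [h1] at this
          omega
        rw [h1, h2]
        push_cast
        ring
  have hm' : (m : ℝ) ≠ 0 := by exact_mod_cast hm.ne'
  have hfr : Int.fract ((N : ℝ) / m) = ((N % m : ℕ) : ℝ) / m :=
    Int.fract_div_natCast_eq_div_natCast_mod
  have hN : (N : ℝ) = m * ((N / m : ℕ) : ℝ) + ((N % m : ℕ) : ℝ) := by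
    exact_mod_cast (Nat.div_add_mod N m).symm
  have hk := key N
  unfold sawtoothPrimitive
  rw [hfr]
  generalize ((N / m : ℕ) : ℝ) = a at *
  generalize ((N % m : ℕ) : ℝ) = b at *
  rw [hN]
  field_simp
  linear_combination (m : ℝ) * hk

/-- Legendre's formula for the sum of digits, with any sufficiently large number of terms. -/
theorem sumOfDigits_eq_sub (q n J : ℕ) (hq : 2 ≤ q) (hn : n < q ^ (J + 1)) :
    (sumOfDigits q n : ℝ) =
      n - ((q : ℝ) - 1) * ∑ j ∈ Finset.range J, ((n / q ^ (j + 1) : ℕ) : ℝ) := by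
  have h := Nat.sub_one_mul_sum_log_div_pow_eq_sub_sum_digits (p := q) n
  have hle : (Nat.digits q n).sum ≤ n := Nat.digit_sum_le q n
  have hz : ∀ j, n < q ^ (j + 1) → n / q ^ (j + 1) = 0 := fun j hj => Nat.div_eq_of_lt hj
  have hext : ∀ A B : ℕ, n < q ^ (A + 1) → A ≤ B →
      ∑ j ∈ Finset.range B, n / q ^ (j + 1) = ∑ j ∈ Finset.range A, n / q ^ (j + 1) := by
    intro A B hA hAB
    symm
    apply Finset.sum_subset (Finset.range_mono hAB)
    intro j _ hj
    apply hz
    refine hA.trans_le (Nat.pow_le_pow_right (by omega) ?_)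
    simp only [Finset.mem_range, not_lt] at hj
    omega
  have hlog : n < q ^ (Nat.log q n + 1) := Nat.lt_pow_succ_log_self (by omega) n
  -- Both truncations are compared through a common longer range; all extra terms are zero.
  have hS : ∑ j ∈ Finset.range J, n / q ^ (j + 1) =
      ∑ j ∈ Finset.range (Nat.log q n).succ, n / q ^ j.succ := by
    rw [← hext J (max J (Nat.log q n + 1)) hn (le_max_left _ _), hext (Nat.log q n) _ hlog
      (le_trans (Nat.le_succ _) (le_max_right _ _)),
      ← hext (Nat.log q n) (Nat.log q n).succ hlog (Nat.le_succ _)]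
  rw [← hS] at h
  have h2 : (((q - 1 : ℕ) : ℝ)) * ((∑ j ∈ Finset.range J, n / q ^ (j + 1) : ℕ) : ℝ) =
      ((n - (Nat.digits q n).sum : ℕ) : ℝ) := by exact_mod_cast h
  rw [Nat.cast_sub hle, Nat.cast_sub (by omega : 1 ≤ q)] at h2
  push_cast at h2
  unfold sumOfDigits
  push_cast
  linarith

/-- The summatory function of the sum of digits. -/
theorem sum_sumOfDigits (q N L : ℕ) (hq : 2 ≤ q) (hN : N ≤ q ^ (L + 1)) :
    ∑ n ∈ Finset.range N, (sumOfDigits q n : ℝ) =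
      N * ((N / (q : ℝ) ^ L - 1) / 2 + ((q : ℝ) - 1) / 2 * L)
        - ((q : ℝ) - 1) * ∑ j ∈ Finset.range L,
          (q : ℝ) ^ (j + 1) * sawtoothPrimitive (N / (q : ℝ) ^ (j + 1)) := by
  have hq0 : (q : ℝ) ≠ 0 := by positivity
  have hgeom : ∀ L : ℕ, ((q : ℝ) - 1) * ∑ j ∈ Finset.range L, 1 / (q : ℝ) ^ (j + 1) =
      1 - 1 / (q : ℝ) ^ L := by
    intro L
    induction L with
    | zero => simp
    | succ L ih =>
      rw [Finset.sum_range_succ, mul_add, ih]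
      field_simp
      ring
  have hid : ∑ n ∈ Finset.range N, (n : ℝ) = (N : ℝ) * (N - 1) / 2 := by
    clear hN
    induction N with
    | zero => simp
    | succ N ih => rw [Finset.sum_range_succ, ih]; push_cast; ring
  rw [Finset.sum_congr rfl fun n hn => sumOfDigits_eq_sub q n L hq
    ((Finset.mem_range.1 hn).trans_le hN), Finset.sum_sub_distrib, ← Finset.mul_sum,
    Finset.sum_comm, hid]
  rw [Finset.sum_congr rfl fun j _ => sum_range_div_eq (q ^ (j + 1)) N (by positivity)]
  push_cast
  rw [Finset.sum_add_distrib, Finset.sum_sub_distrib]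
  have h1 : ∑ j ∈ Finset.range L, (N : ℝ) ^ 2 / (2 * (q : ℝ) ^ (j + 1)) =
      (N : ℝ) ^ 2 / 2 * ∑ j ∈ Finset.range L, 1 / (q : ℝ) ^ (j + 1) := by
    rw [Finset.mul_sum]
    refine Finset.sum_congr rfl fun j _ => ?_
    field_simp
  rw [h1]
  simp only [Finset.sum_const, Finset.card_range, nsmul_eq_mul]
  linear_combination (-(N : ℝ) ^ 2 / 2) * hgeom L

/-! ### Construction of the fluctuation -/

/-- The damped oscillation `y ↦ G(q^y) / q^y`, where `G` is the primitive of the sawtooth. -/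
noncomputable def dampedSawtooth (q : ℕ) (y : ℝ) : ℝ :=
  sawtoothPrimitive ((q : ℝ) ^ y) / (q : ℝ) ^ y

theorem continuous_dampedSawtooth {q : ℕ} (hq : 2 ≤ q) : Continuous (dampedSawtooth q) := by
  have hq0 : (0 : ℝ) < q := by positivity
  have h : Continuous fun y : ℝ => (q : ℝ) ^ y := Real.continuous_const_rpow hq0.ne'
  exact (continuous_sawtoothPrimitive.comp h).div h fun y => (Real.rpow_pos_of_pos hq0 y).ne'

theorem norm_dampedSawtooth_add_le {q : ℕ} (hq : 2 ≤ q) {x : ℝ} (hx : 0 ≤ x) (r : ℕ) :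
    ‖dampedSawtooth q (x + r)‖ ≤ (1 / (q : ℝ)) ^ r := by
  have hq0 : (0 : ℝ) < q := by positivity
  have hq1 : (1 : ℝ) ≤ q := by exact_mod_cast (by omega : 1 ≤ q)
  rw [dampedSawtooth, Real.norm_of_nonneg
      (div_nonneg (sawtoothPrimitive_nonneg _) (Real.rpow_nonneg hq0.le _)),
    one_div, inv_pow, ← one_div]
  refine div_le_div₀ zero_le_one (sawtoothPrimitive_le_one _) (by positivity) ?_
  rw [← Real.rpow_natCast]
  exact Real.rpow_le_rpow_of_exponent_le hq1 (by linarith)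

theorem summable_one_div_pow {q : ℕ} (hq : 2 ≤ q) : Summable fun r : ℕ => (1 / (q : ℝ)) ^ r := by
  have hq1 : (1 : ℝ) < q := by exact_mod_cast (by omega : 1 < q)
  exact summable_geometric_of_lt_one (by positivity) ((div_lt_one (by positivity)).2 hq1)

/-- The restriction to `[0, 1]` of the periodic fluctuation of the sum of digits. -/
noncomputable def fluctuationProfile (q : ℕ) (x : ℝ) : ℝ :=
  ((q : ℝ) ^ x - 1 - ((q : ℝ) - 1) * x) / 2 - ((q : ℝ) - 1) * ∑' r : ℕ, dampedSawtooth q (x + r)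

theorem continuousOn_fluctuationProfile {q : ℕ} (hq : 2 ≤ q) :
    ContinuousOn (fluctuationProfile q) (Set.Icc 0 1) := by
  have hq0 : (0 : ℝ) < q := by positivity
  have h : Continuous fun y : ℝ => (q : ℝ) ^ y := Real.continuous_const_rpow hq0.ne'
  have hc := continuous_dampedSawtooth hq
  have hsum : ContinuousOn (fun x : ℝ => ∑' r : ℕ, dampedSawtooth q (x + r)) (Set.Icc 0 1) :=
    continuousOn_tsum (fun r => (hc.comp (by fun_prop)).continuousOn) (summable_one_div_pow hq)
      fun r x hx => norm_dampedSawtooth_add_le hq hx.1 r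
  unfold fluctuationProfile
  fun_prop

/-- This makes the series vanish at 0 and 1, so the profile, whose other part is an exponential
minus its chord, has equal end values. -/
theorem dampedSawtooth_natCast (q r : ℕ) : dampedSawtooth q r = 0 := by
  have : ((q : ℝ) ^ (r : ℝ)) = ((q ^ r : ℕ) : ℝ) := by simp
  rw [dampedSawtooth, this, sawtoothPrimitive_natCast, zero_div]

theorem fluctuationProfile_zero (q : ℕ) : fluctuationProfile q 0 = 0 := by
  simp [fluctuationProfile, dampedSawtooth_natCast]

theorem fluctuationProfile_one (q : ℕ) : fluctuationProfile q 1 = 0 := by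
  have h : ∀ r : ℕ, dampedSawtooth q (1 + r) = 0 := fun r => by
    have := dampedSawtooth_natCast q (1 + r)
    push_cast at this
    exact this
  simp [fluctuationProfile, h]

theorem isDigitFluctuation_fluctuationProfile_fract {q : ℕ} (hq : 2 ≤ q) :
    IsDigitFluctuation q fun x => fluctuationProfile q (Int.fract x) where
  continuous := (continuousOn_fluctuationProfile hq).comp_fract''
    (by rw [fluctuationProfile_zero, fluctuationProfile_one])
  periodic x := by simp
  value N hN := by
    have hq0 : (0 : ℝ) < q := by positivity
    have hq1 : (1 : ℝ) < q := by exact_mod_cast (by omega : 1 < q)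
    have hN0 : (0 : ℝ) < N := by exact_mod_cast hN
    set L := Nat.log q N with hL
    have hfl : ⌊Real.logb q N⌋ = (L : ℤ) := by
      rw [Real.floor_logb_natCast hN0.le, Int.log_natCast]
    have hx : Int.fract (Real.logb q N) = Real.logb q N - L := by
      rw [Int.fract, hfl]; simp
    have hpow : (q : ℝ) ^ (Real.logb q N) = N := Real.rpow_logb hq0 hq1.ne' hN0
    have hpow' : ∀ r : ℕ, (q : ℝ) ^ (Real.logb q N - L + r) = N * (q : ℝ) ^ r / (q : ℝ) ^ L := by
      intro r
      rw [Real.rpow_add hq0, Real.rpow_sub hq0, hpow, Real.rpow_natCast, Real.rpow_natCast]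
      ring
    have hsum : ∑' r : ℕ, dampedSawtooth q (Real.logb q N - L + r) =
        1 / N * ∑ j ∈ Finset.range L,
          (q : ℝ) ^ (j + 1) * sawtoothPrimitive (N / (q : ℝ) ^ (j + 1)) := by
      -- The indices correspond by r = L - 1 - j; for r ≥ L the argument N q^(r-L) is an integer.
      rw [tsum_eq_sum (s := Finset.range L), ← Finset.sum_range_reflect, Finset.mul_sum]
      · refine Finset.sum_congr rfl fun j hj => ?_
        have hj' : L - 1 - j + (j + 1) = L := by
          have := Finset.mem_range.1 hj
          omega
        have h2 : (N : ℝ) * (q : ℝ) ^ (L - 1 - j) / (q : ℝ) ^ L = N / (q : ℝ) ^ (j + 1) := by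
          have h3 : (q : ℝ) ^ L = (q : ℝ) ^ (L - 1 - j) * (q : ℝ) ^ (j + 1) := by
            rw [← pow_add, hj']
          rw [h3]
          field_simp
        rw [dampedSawtooth, hpow', h2]
        field_simp
      · intro r hr
        have hr' : L ≤ r := by simpa using hr
        have h2 : (N : ℝ) * (q : ℝ) ^ r / (q : ℝ) ^ L = ((N * q ^ (r - L) : ℕ) : ℝ) := by
          rw [← Nat.sub_add_cancel hr', pow_add]
          push_cast
          field_simp
          simp
        rw [dampedSawtooth, hpow', h2, sawtoothPrimitive_natCast, zero_div]
    rw [hx, fluctuationProfile, hsum,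
      sum_sumOfDigits q N L hq (Nat.lt_pow_succ_log_self (by omega) N).le]
    have := hpow' 0
    simp only [Nat.cast_zero, add_zero, pow_zero, mul_one] at this
    rw [this]
    field_simp
    ring

/-! ### Uniqueness -/

/-- The values at `log_q N` determine a digit fluctuation. -/
theorem IsDigitFluctuation.unique {q : ℕ} (hq : 2 ≤ q) {Ψ Φ : ℝ → ℝ}
    (hΨ : IsDigitFluctuation q Ψ) (hΦ : IsDigitFluctuation q Φ) : Ψ = Φ := by
  have hq0 : (0 : ℝ) < q := by positivity
  have hq1 : (1 : ℝ) < q := by exact_mod_cast (by omega : 1 < q)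
  funext x
  -- With N_m = ⌊q^(x+m)⌋, the points log_q N_m - m tend to x, and both functions agree there by
  -- periodicity.
  have hexp : Filter.Tendsto (fun m : ℕ => (q : ℝ) ^ (x + m)) Filter.atTop Filter.atTop :=
    (tendsto_rpow_atTop_of_base_gt_one _ hq1).comp
      (Filter.tendsto_atTop_add_const_left _ _ tendsto_natCast_atTop_atTop)
  have hfloor : Filter.Tendsto (fun m : ℕ => (⌊(q : ℝ) ^ (x + m)⌋₊ : ℝ) / (q : ℝ) ^ (x + m))
      Filter.atTop (nhds 1) := tendsto_nat_floor_div_atTop.comp hexp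
  have hlog : Filter.Tendsto (fun m : ℕ => x + Real.logb q
      ((⌊(q : ℝ) ^ (x + m)⌋₊ : ℝ) / (q : ℝ) ^ (x + m))) Filter.atTop (nhds x) := by
    have h : Filter.Tendsto (fun m : ℕ => Real.logb q
      ((⌊(q : ℝ) ^ (x + m)⌋₊ : ℝ) / (q : ℝ) ^ (x + m))) Filter.atTop (nhds (Real.logb q 1)) :=
      (Real.continuousAt_logb one_ne_zero).tendsto.comp hfloor
    simpa using h.const_add x
  refine tendsto_nhds_unique ((hΨ.continuous.tendsto x).comp hlog)
    (((hΦ.continuous.tendsto x).comp hlog).congr' ?_)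
  filter_upwards [hexp.eventually_ge_atTop 1] with m hm
  have hN : 1 ≤ ⌊(q : ℝ) ^ (x + m)⌋₊ := Nat.one_le_floor_iff _ |>.2 hm
  have hN0 : (⌊(q : ℝ) ^ (x + m)⌋₊ : ℝ) ≠ 0 := by positivity
  have harg : x + Real.logb q ((⌊(q : ℝ) ^ (x + m)⌋₊ : ℝ) / (q : ℝ) ^ (x + m)) =
      Real.logb q (⌊(q : ℝ) ^ (x + m)⌋₊ : ℝ) - m * 1 := by
    rw [Real.logb_div hN0 (by positivity), Real.logb_rpow hq0 hq1.ne']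
    ring
  simp only [Function.comp_apply, harg, hΨ.periodic.sub_nat_mul_eq, hΦ.periodic.sub_nat_mul_eq]
  rw [hΨ.value _ hN, hΦ.value _ hN]

/-! ### The Mellin integral of the sawtooth primitive and `ζ` -/

open MeasureTheory Filter

/-- The right derivative exists even at the integers, where G has a corner; it suffices for the
fundamental theorem of calculus. -/
theorem hasDerivWithinAt_sawtoothPrimitive (x : ℝ) :
    HasDerivWithinAt sawtoothPrimitive (1 / 2 - Int.fract x) (Set.Ioi x) x := by
  have h : HasDerivAt (fun v : ℝ => (v - ⌊x⌋) * (1 - (v - ⌊x⌋)) / 2) (1 / 2 - Int.fract x) x := by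
    have h1 : HasDerivAt (fun v : ℝ => v - ⌊x⌋) 1 x := (hasDerivAt_id x).sub_const _
    have h2 := (h1.mul (h1.const_sub 1)).div_const 2
    refine h2.congr_deriv ?_
    rw [← Int.self_sub_floor]
    ring
  refine h.hasDerivWithinAt.congr_of_eventuallyEq ?_ rfl
  have hlt : x < ⌊x⌋ + 1 := Int.lt_floor_add_one x
  filter_upwards [Ioo_mem_nhdsGT hlt] with v hv
  have : ⌊v⌋ = ⌊x⌋ := Int.floor_eq_iff.2 ⟨(Int.floor_le x).trans hv.1.le, hv.2⟩
  rw [sawtoothPrimitive, Int.fract, this]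

/-- The Mellin-type integral `∫_1^∞ G(v) v^(-2-s) dv` of the primitive `G` of the sawtooth. -/
noncomputable def sawtoothMellin (s : ℂ) : ℂ :=
  ∫ v in Set.Ioi (1 : ℝ), (v : ℂ) ^ (-2 - s) * (sawtoothPrimitive v : ℂ)

theorem integrableOn_cpow_mul_of_bounded {f : ℝ → ℝ} (hf : Measurable f) (hb : ∀ v, |f v| ≤ 1)
    {a : ℂ} (ha : a.re < -1) :
    IntegrableOn (fun v : ℝ => (v : ℂ) ^ a * (f v : ℂ)) (Set.Ioi 1) := by
  refine (integrableOn_Ioi_cpow_of_lt ha zero_lt_one).mul_bdd (c := 1)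
    (Complex.measurable_ofReal.comp hf).aestronglyMeasurable ?_
  exact .of_forall fun v => by simpa using hb v

theorem abs_sawtoothPrimitive_le_one (v : ℝ) : |sawtoothPrimitive v| ≤ 1 := by
  rw [abs_of_nonneg (sawtoothPrimitive_nonneg v)]
  exact sawtoothPrimitive_le_one v

theorem integrableOn_cpow_mul_sawtoothPrimitive {s : ℂ} (hs : -1 < s.re) :
    IntegrableOn (fun v : ℝ => (v : ℂ) ^ (-2 - s) * (sawtoothPrimitive v : ℂ)) (Set.Ioi 1) :=
  integrableOn_cpow_mul_of_bounded continuous_sawtoothPrimitive.measurable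
    abs_sawtoothPrimitive_le_one (by simp; linarith)

theorem abs_half_sub_fract_le_one (v : ℝ) : |1 / 2 - Int.fract v| ≤ 1 := by
  have h0 := Int.fract_nonneg v
  have h1 := Int.fract_lt_one v
  rw [abs_le]
  constructor <;> linarith

theorem integrableOn_cpow_mul_half_sub_fract {s : ℂ} (hs : 0 < s.re) :
    IntegrableOn (fun v : ℝ => (v : ℂ) ^ (-1 - s) * ((1 / 2 - Int.fract v : ℝ) : ℂ))
      (Set.Ioi 1) :=
  integrableOn_cpow_mul_of_bounded (by fun_prop) abs_half_sub_fract_le_one (by simp; linarith)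

/-- Integration by parts against the sawtooth. -/
theorem one_add_mul_sawtoothMellin {s : ℂ} (hs : 0 < s.re) :
    (1 + s) * sawtoothMellin s =
      ∫ v in Set.Ioi (1 : ℝ), (v : ℂ) ^ (-1 - s) * ((1 / 2 - Int.fract v : ℝ) : ℂ) := by
  have hI1 := integrableOn_cpow_mul_sawtoothPrimitive (s := s) (by linarith)
  have hI2 := integrableOn_cpow_mul_half_sub_fract hs
  have hI : IntegrableOn (fun v : ℝ => (-1 - s) * ((v : ℂ) ^ (-2 - s) * (sawtoothPrimitive v : ℂ)) +
      (v : ℂ) ^ (-1 - s) * ((1 / 2 - Int.fract v : ℝ) : ℂ)) (Set.Ioi 1) :=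
    (hI1.const_mul (-1 - s)).add hI2
  have hlim := intervalIntegral_tendsto_integral_Ioi 1 hI tendsto_natCast_atTop_atTop
  -- The integrand is the right derivative of v^(-1-s) G(v), and G vanishes at both integer
  -- endpoints.
  have hzero : ∀ᶠ N : ℕ in atTop, ∫ v in (1 : ℝ)..(N : ℝ),
      ((-1 - s) * ((v : ℂ) ^ (-2 - s) * (sawtoothPrimitive v : ℂ)) +
        (v : ℂ) ^ (-1 - s) * ((1 / 2 - Int.fract v : ℝ) : ℂ)) = 0 := by
    filter_upwards [eventually_ge_atTop 1] with N hN
    have hN' : (1 : ℝ) ≤ N := by exact_mod_cast hN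
    have h1 : sawtoothPrimitive 1 = 0 := by simpa using sawtoothPrimitive_natCast 1
    rw [intervalIntegral.integral_eq_sub_of_hasDeriv_right_of_le hN'
      (f := fun v : ℝ => (v : ℂ) ^ (-1 - s) * (sawtoothPrimitive v : ℂ))]
    · rw [sawtoothPrimitive_natCast, h1]
      simp
    · refine ContinuousOn.mul (fun v hv => ?_)
        (Complex.continuous_ofReal.comp continuous_sawtoothPrimitive).continuousOn
      exact (Complex.continuousAt_ofReal_cpow_const _ _
        (Or.inr (zero_lt_one.trans_le hv.1).ne')).continuousWithinAt
    · intro v hv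
      have hv0 : v ≠ 0 := by have := hv.1; linarith
      have hne : (-1 - s : ℂ) ≠ 0 := by
        intro h
        have := congrArg Complex.re h
        simp at this
        linarith
      have hd : HasDerivAt (fun v : ℝ => (v : ℂ) ^ (-1 - s)) ((-1 - s) * (v : ℂ) ^ (-1 - s - 1)) v :=
        hasDerivAt_ofReal_cpow_const hv0 hne
      refine (hd.hasDerivWithinAt.mul
        (hasDerivWithinAt_sawtoothPrimitive v).ofReal_comp).congr_deriv ?_
      rw [show -1 - s - 1 = -2 - s by ring]
      ring
    · rw [intervalIntegrable_iff_integrableOn_Ioc_of_le hN']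
      exact hI.mono_set Set.Ioc_subset_Ioi_self
  have h0 := tendsto_nhds_unique hlim (tendsto_const_nhds.congr' (hzero.mono fun _ h => h.symm))
  rw [integral_add (hI1.const_mul (-1 - s)) hI2, integral_const_mul] at h0
  rw [sawtoothMellin]
  linear_combination -h0

/-- The integral representation of `ζ` through the integer part. -/
theorem riemannZeta_eq_mul_integral_floor {s : ℂ} (hs : 1 < s.re) :
    riemannZeta s = s * ∫ t in Set.Ioi (1 : ℝ), (⌊t⌋₊ : ℂ) * (t : ℂ) ^ (-(s + 1)) := by
  have h := LSeries_eq_mul_integral' (fun _ => (1 : ℂ)) zero_le_one hs (by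
    simpa using Asymptotics.isBigO_refl (fun n : ℕ => (n : ℝ)) atTop)
  rw [← LSeries_one_eq_riemannZeta hs, show (1 : ℕ → ℂ) = fun _ => 1 from rfl]
  simpa using h

/-- Write ⌊v⌋ = v - 1/2 + (1/2 - fract v) in the integral for `ζ`. Denominators are cleared so that
both sides continue holomorphically across 0 and 1. -/
theorem sawtoothMellin_eq_of_one_lt_re {s : ℂ} (hs : 1 < s.re) :
    s * (s + 1) * (s - 1) * sawtoothMellin s = (s - 1) * riemannZeta s - s + (s - 1) / 2 := by
  have hs0 : s ≠ 0 := by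
    intro h
    rw [h] at hs
    simp at hs
    linarith
  have hs1 : s - 1 ≠ 0 := by
    intro h
    have := congrArg Complex.re h
    simp at this
    linarith
  have hA : IntegrableOn (fun v : ℝ => (v : ℂ) ^ (-1 - s)) (Set.Ioi 1) :=
    integrableOn_Ioi_cpow_of_lt (by simp; linarith) zero_lt_one
  have hB : IntegrableOn (fun v : ℝ => (v : ℂ) ^ (-s)) (Set.Ioi 1) :=
    integrableOn_Ioi_cpow_of_lt (by simp; linarith) zero_lt_one
  have hC := integrableOn_cpow_mul_half_sub_fract (s := s) (by linarith)
  have hD : IntegrableOn (fun v : ℝ => (v : ℂ) ^ (-s) - 1 / 2 * (v : ℂ) ^ (-1 - s)) (Set.Ioi 1) :=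
    hB.sub (hA.const_mul _)
  have hfl : ∀ v ∈ Set.Ioi (1 : ℝ), (⌊v⌋₊ : ℂ) * (v : ℂ) ^ (-(s + 1)) =
      (v : ℂ) ^ (-1 - s) * ((1 / 2 - Int.fract v : ℝ) : ℂ) +
        ((v : ℂ) ^ (-s) - 1 / 2 * (v : ℂ) ^ (-1 - s)) := by
    intro v hv
    have hv0 : (0 : ℝ) < v := lt_trans zero_lt_one hv
    have hv0' : (v : ℂ) ≠ 0 := by exact_mod_cast hv0.ne'
    have h1 : (⌊v⌋₊ : ℂ) = v - ((Int.fract v : ℝ) : ℂ) := by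
      have : (⌊v⌋₊ : ℝ) = v - Int.fract v := by
        rw [natCast_floor_eq_intCast_floor hv0.le]
        simp
      exact_mod_cast congrArg (fun x : ℝ => (x : ℂ)) this
    have h2 : (v : ℂ) ^ (-s) = v * (v : ℂ) ^ (-1 - s) := by
      rw [show -s = 1 + (-1 - s) by ring, Complex.cpow_add _ _ hv0', Complex.cpow_one]
    rw [h1, h2, show -(s + 1) = -1 - s by ring]
    push_cast
    ring
  have hz := riemannZeta_eq_mul_integral_floor hs
  rw [setIntegral_congr_fun measurableSet_Ioi hfl, integral_add hC hD,
    integral_sub hB (hA.const_mul _), integral_const_mul,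
    ← one_add_mul_sawtoothMellin (s := s) (by linarith),
    integral_Ioi_cpow_of_lt (by simp; linarith) zero_lt_one,
    integral_Ioi_cpow_of_lt (by simp; linarith) zero_lt_one] at hz
  rw [show -1 - s + 1 = -s by ring, show -s + 1 = -(s - 1) by ring] at hz
  simp only [Complex.ofReal_one, Complex.one_cpow] at hz
  rw [hz]
  field_simp
  ring

theorem sawtoothMellin_eq_mellin (s : ℂ) :
    sawtoothMellin s =
      mellin (Set.indicator (Set.Ioi 1) fun v : ℝ => (sawtoothPrimitive v : ℂ)) (-1 - s) := by
  rw [mellin, sawtoothMellin, ← integral_indicator measurableSet_Ioi,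
    ← integral_indicator measurableSet_Ioi]
  congr 1
  funext v
  by_cases hv : v ∈ Set.Ioi (1 : ℝ)
  · have hv0 : v ∈ Set.Ioi (0 : ℝ) := lt_trans zero_lt_one (Set.mem_Ioi.1 hv)
    rw [Set.indicator_of_mem hv, Set.indicator_of_mem hv0, Set.indicator_of_mem hv, smul_eq_mul,
      show -1 - s - 1 = -2 - s by ring]
  · by_cases hv0 : v ∈ Set.Ioi (0 : ℝ) <;> simp only [Set.indicator, hv, hv0, if_true, if_false,
      smul_zero]

theorem differentiableAt_sawtoothMellin {s : ℂ} (hs : -1 < s.re) :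
    DifferentiableAt ℂ sawtoothMellin s := by
  rw [funext sawtoothMellin_eq_mellin]
  have hc : Continuous fun v : ℝ => (sawtoothPrimitive v : ℂ) :=
    Complex.continuous_ofReal.comp continuous_sawtoothPrimitive
  have h : DifferentiableAt ℂ
      (mellin (Set.indicator (Set.Ioi 1) fun v : ℝ => (sawtoothPrimitive v : ℂ))) (-1 - s) := by
    -- Boundedness gives a = 0, the source of re s > -1; vanishing near 0 allows any b below the
    -- real part.
    refine mellin_differentiableAt_of_isBigO_rpow (a := 0) (b := (-1 - s).re - 1) ?_ ?_ ?_ ?_ ?_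
    · exact (hc.locallyIntegrable.indicator measurableSet_Ioi).locallyIntegrableOn _
    · refine Asymptotics.IsBigO.of_bound 1 (.of_forall fun v => ?_)
      refine (norm_indicator_le_norm_self _ _).trans ?_
      simpa using abs_sawtoothPrimitive_le_one v
    · simp; linarith
    · refine (Asymptotics.isBigO_zero _ _).congr' ?_ .rfl
      filter_upwards [Ioo_mem_nhdsGT (zero_lt_one (α := ℝ))] with v hv
      rw [Set.indicator_of_notMem (by simpa using hv.2.le)]
    · linarith
  exact h.comp s (by fun_prop)

/-- The continuation of the integral representation of `ζ` to the half-plane `re s > -1`. -/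
theorem sawtoothMellin_eq {s : ℂ} (hs : -1 < s.re) :
    s * (s + 1) * (s - 1) * sawtoothMellin s = riemannZeta₁ s - s + (s - 1) / 2 := by
  have hU : IsOpen {s : ℂ | -1 < s.re} := isOpen_lt continuous_const Complex.continuous_re
  -- Identity theorem on a convex half-plane, from agreement near 2.
  refine AnalyticOnNhd.eqOn_of_preconnected_of_eventuallyEq (𝕜 := ℂ)
    (f := fun s => s * (s + 1) * (s - 1) * sawtoothMellin s)
    (g := fun s => riemannZeta₁ s - s + (s - 1) / 2) (U := {s : ℂ | -1 < s.re}) (z₀ := 2)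
    ?_ ?_ (convex_halfSpace_re_gt (-1)).isPreconnected (by simp; norm_num) ?_ hs
  · refine DifferentiableOn.analyticOnNhd (fun s hs => ?_) hU
    have := differentiableAt_sawtoothMellin hs
    exact DifferentiableAt.differentiableWithinAt (by fun_prop)
  · exact DifferentiableOn.analyticOnNhd (Differentiable.differentiableOn (by fun_prop)) hU
  · filter_upwards [(isOpen_lt continuous_const Complex.continuous_re).mem_nhds
      (by simp : (2 : ℂ) ∈ {s : ℂ | 1 < s.re})] with s hs
    have hs1 : s ≠ 1 := by
      rintro rfl
      simp at hs
    rw [sawtoothMellin_eq_of_one_lt_re hs, riemannZeta_eq_inv_sub_mul hs1,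
      mul_inv_cancel_left₀ (sub_ne_zero.2 hs1)]

theorem sawtoothMellin_eq_riemannZeta {s : ℂ} (hs : -1 < s.re) (h0 : s ≠ 0) (h1 : s ≠ 1) :
    sawtoothMellin s = riemannZeta s / (s * (s + 1)) + 1 / (2 * s * (1 - s)) := by
  have h := sawtoothMellin_eq hs
  have h1' : s - 1 ≠ 0 := sub_ne_zero.2 h1
  have h1'' : 1 - s ≠ 0 := sub_ne_zero.2 h1.symm
  have h2 : s + 1 ≠ 0 := by
    intro h
    have := congrArg Complex.re h
    simp at this
    linarith
  have hz := riemannZeta_eq_inv_sub_mul h1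
  have hz1 : riemannZeta₁ s = (s - 1) * riemannZeta s := by
    rw [hz, mul_inv_cancel_left₀ h1']
  rw [hz1] at h
  apply mul_left_cancel₀ (mul_ne_zero (mul_ne_zero h0 h2) h1')
  rw [h]
  field_simp
  ring

/-- Differentiating the cleared identity at 0 leaves -M(0) = ζ(0) - ζ'(0) - 1/2. -/
theorem sawtoothMellin_zero : sawtoothMellin 0 = 1 - Complex.log (2 * Real.pi) / 2 := by
  have hU : IsOpen {s : ℂ | -1 < s.re} := isOpen_lt continuous_const Complex.continuous_re
  have hM := (differentiableAt_sawtoothMellin (s := 0) (by simp)).hasDerivAt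
  have hid := hasDerivAt_id (0 : ℂ)
  have hL := ((hid.mul (hid.add_const 1)).mul (hid.sub_const 1)).mul hM
  have hZ : HasDerivAt riemannZeta (-Complex.log (2 * Real.pi) / 2) 0 := by
    rw [← deriv_riemannZeta_zero]
    exact (differentiableAt_riemannZeta zero_ne_one).hasDerivAt
  have hR := (((hid.sub_const 1).mul hZ).sub hid).add ((hid.sub_const 1).div_const 2)
  have heq := hL.unique (hR.congr_of_eventuallyEq ?_)
  · simp only [id_eq, Pi.mul_apply, riemannZeta_zero] at heq
    linear_combination -heq
  · filter_upwards [hU.mem_nhds (by simp : (0 : ℂ) ∈ {s : ℂ | -1 < s.re}),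
      isOpen_ne.mem_nhds (zero_ne_one (α := ℂ))] with s hs hs1
    have h := sawtoothMellin_eq hs
    have hz1 : riemannZeta₁ s = (s - 1) * riemannZeta s := by
      rw [riemannZeta_eq_inv_sub_mul hs1, mul_inv_cancel_left₀ (sub_ne_zero.2 hs1)]
    rw [hz1] at h
    simpa using h

/-! ### Fourier coefficients -/

theorem chi_mul_log {q : ℕ} (hq : 2 ≤ q) (k : ℤ) :
    chi q k * (Real.log q : ℂ) = 2 * Real.pi * Complex.I * k := by
  have h : Real.log q ≠ 0 := (Real.log_pos (by exact_mod_cast (by omega : 1 < q))).ne'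
  rw [chi, div_mul_cancel₀ _ (by exact_mod_cast h)]

theorem chi_re (q : ℕ) (k : ℤ) : (chi q k).re = 0 := by
  have h : chi q k = ((2 * Real.pi * k / Real.log q : ℝ) : ℂ) * Complex.I := by
    rw [chi]
    push_cast
    ring
  rw [h, Complex.re_ofReal_mul, Complex.I_re, mul_zero]

theorem exp_chi_mul_log {q : ℕ} (hq : 2 ≤ q) (k : ℤ) :
    Complex.exp (-(chi q k * (Real.log q : ℂ))) = 1 := by
  rw [chi_mul_log hq, Complex.exp_eq_one_iff]
  exact ⟨-k, by push_cast; ring⟩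

/-- Substitute v = q^y, so that dv = v log q dy. -/
theorem integral_dampedSawtooth {q : ℕ} (hq : 2 ≤ q) (s : ℂ) (R : ℕ) :
    (Real.log q : ℂ) * ∫ y in (0 : ℝ)..R,
        (dampedSawtooth q y : ℂ) * Complex.exp (-(s * (Real.log q : ℂ)) * y) =
      ∫ v in (1 : ℝ)..(q : ℝ) ^ R, (v : ℂ) ^ (-2 - s) * (sawtoothPrimitive v : ℂ) := by
  have hq0 : (0 : ℝ) < q := by positivity
  have hpos : ∀ y : ℝ, 0 < (q : ℝ) ^ y := fun y => Real.rpow_pos_of_pos hq0 y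
  have hcont : Continuous fun y : ℝ => (q : ℝ) ^ y := Real.continuous_const_rpow hq0.ne'
  have h := intervalIntegral.integral_deriv_smul_comp' (a := 0) (b := (R : ℝ))
    (f := fun y : ℝ => (q : ℝ) ^ y) (f' := fun y : ℝ => (q : ℝ) ^ y * Real.log q)
    (g := fun v : ℝ => (v : ℂ) ^ (-2 - s) * (sawtoothPrimitive v : ℂ))
    (fun y _ => Real.hasStrictDerivAt_const_rpow hq0 y |>.hasDerivAt) (by fun_prop) (by
      refine ContinuousOn.mul ?_
        (Complex.continuous_ofReal.comp continuous_sawtoothPrimitive).continuousOn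
      rintro _ ⟨y, _, rfl⟩
      exact (Complex.continuousAt_ofReal_cpow_const _ _
        (Or.inr (hpos y).ne')).continuousWithinAt)
  rw [Real.rpow_zero, Real.rpow_natCast] at h
  rw [← h, ← intervalIntegral.integral_const_mul]
  refine intervalIntegral.integral_congr fun y _ => ?_
  have hexp : ((q : ℝ) ^ y : ℝ) = Real.exp (Real.log q * y) := Real.rpow_def_of_pos hq0 y
  have hcpow : (((q : ℝ) ^ y : ℝ) : ℂ) ^ (-2 - s) =
      Complex.exp (-(s * (Real.log q : ℂ)) * y) / (((q : ℝ) ^ y : ℝ) : ℂ) ^ 2 := by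
    rw [Complex.cpow_def_of_ne_zero (by exact_mod_cast (hpos y).ne'),
      ← Complex.ofReal_log (hpos y).le, Real.log_rpow hq0, eq_div_iff
      (pow_ne_zero _ (by exact_mod_cast (hpos y).ne')), hexp, Complex.ofReal_exp,
      ← Complex.exp_nat_mul, ← Complex.exp_add]
    congr 1
    push_cast
    ring
  have hne : (((q : ℝ) ^ y : ℝ) : ℂ) ≠ 0 := by exact_mod_cast (hpos y).ne'
  simp only [Function.comp_apply, hcpow, dampedSawtooth, Complex.real_smul, Complex.ofReal_mul,
    Complex.ofReal_div]
  field_simp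

/-- Unfolding the periodized damped sawtooth turns its Fourier coefficients into values of the
Mellin-type integral. -/
theorem integral_tsum_dampedSawtooth {q : ℕ} (hq : 2 ≤ q) (k : ℤ) :
    ∫ x in (0 : ℝ)..1, ((∑' r : ℕ, dampedSawtooth q (x + r) : ℝ) : ℂ) *
        Complex.exp (-(chi q k * (Real.log q : ℂ)) * x) =
      sawtoothMellin (chi q k) / (Real.log q : ℂ) := by
  have hq1 : (1 : ℝ) < q := by exact_mod_cast (by omega : 1 < q)
  have hlog : (Real.log q : ℂ) ≠ 0 := by exact_mod_cast (Real.log_pos hq1).ne'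
  set c : ℂ := -(chi q k * (Real.log q : ℂ)) with hc
  have hc' : c = ((-(2 * Real.pi * k) : ℝ) : ℂ) * Complex.I := by
    rw [hc, chi_mul_log hq]
    push_cast
    ring
  have hnorm : ∀ x : ℝ, ‖Complex.exp (c * x)‖ = 1 := fun x => by
    rw [hc', mul_right_comm, ← Complex.ofReal_mul, Complex.norm_exp_ofReal_mul_I]
  have hper : ∀ (x : ℝ) (r : ℕ), Complex.exp (c * ((x + r : ℝ) : ℂ)) = Complex.exp (c * x) := by
    intro x r
    have : c * ((x + r : ℝ) : ℂ) = c * x + r * c := by push_cast; ring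
    rw [this, Complex.exp_add, Complex.exp_nat_mul, exp_chi_mul_log hq k, one_pow, mul_one]
  have hcd := continuous_dampedSawtooth hq
  have hint : Continuous fun y : ℝ => (dampedSawtooth q y : ℂ) * Complex.exp (c * y) := by fun_prop
  have hsum : HasSum (fun r : ℕ => ∫ x in (0 : ℝ)..1,
      (dampedSawtooth q (x + r) : ℂ) * Complex.exp (c * x))
      (∫ x in (0 : ℝ)..1, ((∑' r : ℕ, dampedSawtooth q (x + r) : ℝ) : ℂ) *
        Complex.exp (c * x)) := by
    refine intervalIntegral.hasSum_integral_of_dominated_convergence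
      (fun r _ => (1 / (q : ℝ)) ^ r) (fun r => ?_) (fun r => ?_) ?_ ?_ ?_
    · exact Continuous.aestronglyMeasurable (by fun_prop)
    · refine .of_forall fun x hx => ?_
      rw [Set.uIoc_of_le zero_le_one] at hx
      rw [norm_mul, hnorm, mul_one, Complex.norm_real]
      exact norm_dampedSawtooth_add_le hq hx.1.le r
    · exact .of_forall fun x _ => summable_one_div_pow hq
    · exact intervalIntegrable_const
    · refine .of_forall fun x hx => ?_
      rw [Set.uIoc_of_le zero_le_one] at hx
      refine HasSum.mul_right _ (Complex.hasSum_ofReal.2 (Summable.hasSum ?_))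
      exact .of_norm_bounded (summable_one_div_pow hq)
        fun r => norm_dampedSawtooth_add_le hq hx.1.le r
  -- Translating [0,1] by r leaves the exponential unchanged, so the pieces join into an integral
  -- over [0,R].
  have hpart : ∀ R : ℕ, ∑ r ∈ Finset.range R, ∫ x in (0 : ℝ)..1,
      (dampedSawtooth q (x + r) : ℂ) * Complex.exp (c * x) =
      (∫ v in (1 : ℝ)..(q : ℝ) ^ R, (v : ℂ) ^ (-2 - chi q k) * (sawtoothPrimitive v : ℂ)) /
        (Real.log q : ℂ) := by
    intro R
    rw [← integral_dampedSawtooth hq, mul_div_cancel_left₀ _ hlog]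
    have h := intervalIntegral.sum_integral_adjacent_intervals (a := fun r : ℕ => (r : ℝ)) (n := R)
      (μ := volume) (f := fun y : ℝ => (dampedSawtooth q y : ℂ) * Complex.exp (c * y))
      fun r _ => hint.intervalIntegrable _ _
    simp only [Nat.cast_zero] at h
    rw [← h]
    refine Finset.sum_congr rfl fun r _ => ?_
    have h2 := intervalIntegral.integral_comp_add_right (a := 0) (b := 1)
      (fun y : ℝ => (dampedSawtooth q y : ℂ) * Complex.exp (c * y)) (r : ℝ)
    simp only [hper] at h2
    rw [h2, zero_add]
    push_cast
    rw [add_comm (1 : ℝ)]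
  have hlim := intervalIntegral_tendsto_integral_Ioi 1
    (integrableOn_cpow_mul_sawtoothPrimitive (s := chi q k) (by rw [chi_re]; norm_num))
    (tendsto_pow_atTop_atTop_of_one_lt hq1)
  refine tendsto_nhds_unique hsum.tendsto_sum_nat ?_
  simp only [hpart]
  exact hlim.div_const _

theorem fourierCoeffOn_eq_integral_chi {q : ℕ} (hq : 2 ≤ q) (f : ℝ → ℂ) (k : ℤ) :
    fourierCoeffOn (zero_lt_one (α := ℝ)) f k =
      ∫ x in (0 : ℝ)..1, f x * Complex.exp (-(chi q k * (Real.log q : ℂ)) * x) := by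
  rw [fourierCoeffOn_eq_integral, chi_mul_log hq]
  simp only [sub_zero, div_one, one_smul]
  refine intervalIntegral.integral_congr fun x _ => ?_
  simp only [fourier_coe_apply, smul_eq_mul]
  rw [mul_comm]
  congr 2
  push_cast
  ring

theorem ofReal_natCast_rpow {q : ℕ} (hq : 2 ≤ q) (x : ℝ) :
    (((q : ℝ) ^ x : ℝ) : ℂ) = Complex.exp ((Real.log q : ℂ) * x) := by
  rw [Real.rpow_def_of_pos (by positivity)]
  push_cast
  rfl

theorem integral_exponential_sub_chord {q : ℕ} (hq : 2 ≤ q) {c : ℂ} (hc : c ≠ 0)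
    (hc' : (Real.log q : ℂ) + c ≠ 0) (hexp : Complex.exp c = 1) :
    ∫ x in (0 : ℝ)..1, ((((q : ℝ) ^ x - 1 - ((q : ℝ) - 1) * x) / 2 : ℝ) : ℂ) *
        Complex.exp (c * x) =
      ((q : ℂ) - 1) / 2 * (1 / ((Real.log q : ℂ) + c) - 1 / c) := by
  have hq0 : (0 : ℝ) < q := by positivity
  have hd : ∀ (a : ℂ) (x : ℝ), HasDerivAt (fun x : ℝ => Complex.exp (a * x))
      (Complex.exp (a * x) * a) x := by
    intro a x
    have := ((Complex.ofRealCLM.hasDerivAt (x := x)).const_mul a).cexp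
    simpa using this
  have hqexp : Complex.exp (Real.log q : ℂ) = q := by
    rw [← Complex.ofReal_exp, Real.exp_log hq0]
    simp
  rw [intervalIntegral.integral_eq_sub_of_hasDerivAt
    -- The last summand uses the primitive (x/c - 1/c²) e^(cx) of x e^(cx).
    (f := fun x : ℝ => (Complex.exp (((Real.log q : ℂ) + c) * x) / ((Real.log q : ℂ) + c)
      - Complex.exp (c * x) / c
      - ((q : ℂ) - 1) * (((x : ℂ) / c - 1 / c ^ 2) * Complex.exp (c * x))) / 2)]
  · simp only [Complex.ofReal_one, Complex.ofReal_zero, mul_one, mul_zero, Complex.exp_zero,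
      Complex.exp_add, hexp, hqexp]
    field_simp
    ring
  · intro x _
    have hx : HasDerivAt (fun x : ℝ => (x : ℂ)) 1 x := Complex.ofRealCLM.hasDerivAt
    refine ((((hd ((Real.log q : ℂ) + c) x).div_const _).sub ((hd c x).div_const c)).sub
      ((((hx.div_const c).sub_const (1 / c ^ 2)).mul (hd c x)).const_mul
        ((q : ℂ) - 1)) |>.div_const 2).congr_deriv ?_
    rw [mul_div_cancel_right₀ _ hc']
    push_cast [ofReal_natCast_rpow hq]
    rw [add_mul, Complex.exp_add]
    field_simp
    ring
  · apply Continuous.intervalIntegrable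
    have h : Continuous fun y : ℝ => (q : ℝ) ^ y := Real.continuous_const_rpow hq0.ne'
    fun_prop

theorem integral_exponential_sub_chord_zero {q : ℕ} (hq : 2 ≤ q) :
    ∫ x in (0 : ℝ)..1, ((((q : ℝ) ^ x - 1 - ((q : ℝ) - 1) * x) / 2 : ℝ) : ℂ) =
      (((q : ℝ) - 1) / (2 * Real.log q) - ((q : ℝ) + 1) / 4 : ℝ) := by
  have hq0 : (0 : ℝ) < q := by positivity
  have hlog : Real.log q ≠ 0 := (Real.log_pos (by exact_mod_cast (by omega : 1 < q))).ne'
  rw [intervalIntegral.integral_ofReal, intervalIntegral.integral_eq_sub_of_hasDerivAt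
    (f := fun x : ℝ => ((q : ℝ) ^ x / Real.log q - x - ((q : ℝ) - 1) * (x ^ 2 / 2)) / 2)]
  · rw [Real.rpow_one, Real.rpow_zero]
    congr 1
    field_simp
    ring
  · intro x _
    have h := (Real.hasStrictDerivAt_const_rpow hq0 x).hasDerivAt
    refine ((((h.div_const (Real.log q)).sub (hasDerivAt_id x)).sub
      (((hasDerivAt_pow 2 x).div_const 2).const_mul ((q : ℝ) - 1))).div_const 2).congr_deriv ?_
    field_simp
    ring
  · apply Continuous.intervalIntegrable
    have h : Continuous fun y : ℝ => (q : ℝ) ^ y := Real.continuous_const_rpow hq0.ne'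
    fun_prop

/-- The Fourier coefficients of the fluctuation, up to an elementary integral. -/
theorem IsDigitFluctuation.fourierCoeffOn_eq {q : ℕ} (hq : 2 ≤ q) {Ψ : ℝ → ℝ}
    (hΨ : IsDigitFluctuation q Ψ) (k : ℤ) :
    fourierCoeffOn (zero_lt_one (α := ℝ)) (fun x => (Ψ x : ℂ)) k =
      (∫ x in (0 : ℝ)..1, ((((q : ℝ) ^ x - 1 - ((q : ℝ) - 1) * x) / 2 : ℝ) : ℂ) *
        Complex.exp (-(chi q k * (Real.log q : ℂ)) * x)) -
      ((q : ℂ) - 1) * (sawtoothMellin (chi q k) / (Real.log q : ℂ)) := by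
  have hq0 : (0 : ℝ) < q := by positivity
  have hpow : Continuous fun y : ℝ => (q : ℝ) ^ y := Real.continuous_const_rpow hq0.ne'
  have hcd := continuous_dampedSawtooth hq
  have hcsum : ContinuousOn (fun x : ℝ => ∑' r : ℕ, dampedSawtooth q (x + r)) (Set.uIcc 0 1) := by
    rw [Set.uIcc_of_le zero_le_one]
    exact continuousOn_tsum (fun r => (hcd.comp (by fun_prop)).continuousOn)
      (summable_one_div_pow hq) fun r x hx => norm_dampedSawtooth_add_le hq hx.1 r
  have hval : ∀ x ∈ Set.uIcc (0 : ℝ) 1, Ψ x = fluctuationProfile q x := by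
    intro x hx
    rw [Set.uIcc_of_le zero_le_one] at hx
    rw [hΨ.unique hq (isDigitFluctuation_fluctuationProfile_fract hq)]
    rcases hx.2.lt_or_eq with h | rfl
    · simp only [Int.fract_eq_self.2 ⟨hx.1, h⟩]
    · simp only [Int.fract_one, fluctuationProfile_zero, fluctuationProfile_one]
  rw [fourierCoeffOn_eq_integral_chi hq, ← integral_tsum_dampedSawtooth hq,
    ← intervalIntegral.integral_const_mul, ← intervalIntegral.integral_sub]
  · refine intervalIntegral.integral_congr fun x hx => ?_
    simp only [hval x hx, fluctuationProfile]
    push_cast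
    ring
  · exact Continuous.intervalIntegrable (by fun_prop) _ _
  · refine ContinuousOn.intervalIntegrable ?_
    refine continuousOn_const.mul (ContinuousOn.mul ?_ (by fun_prop))
    exact Complex.continuous_ofReal.comp_continuousOn hcsum

theorem corollary1 (q : ℕ) (hq : 2 ≤ q) :
    (∃! Ψ : ℝ → ℝ, IsDigitFluctuation q Ψ) ∧
    ∀ Ψ : ℝ → ℝ, IsDigitFluctuation q Ψ →
      fourierCoeffOn (zero_lt_one (α := ℝ)) (fun x => (Ψ x : ℂ)) 0 =
        ((((q : ℝ) - 1) / (2 * Real.log q) * (Real.log (2 * Real.pi) - 1)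
          - ((q : ℝ) + 1) / 4 : ℝ) : ℂ) ∧
      ∀ k : ℤ, k ≠ 0 →
        fourierCoeffOn (zero_lt_one (α := ℝ)) (fun x => (Ψ x : ℂ)) k =
          -(((q : ℂ) - 1) / (chi q k * (1 + chi q k) * (Real.log q : ℂ)))
            * riemannZeta (chi q k) := by
  have hlog : Real.log q ≠ 0 := (Real.log_pos (by exact_mod_cast (by omega : 1 < q))).ne'
  have hlogC : (Real.log q : ℂ) ≠ 0 := by exact_mod_cast hlog
  refine ⟨⟨_, isDigitFluctuation_fluctuationProfile_fract hq, fun Φ hΦ =>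
    hΦ.unique hq (isDigitFluctuation_fluctuationProfile_fract hq)⟩, fun Ψ hΨ => ⟨?_, ?_⟩⟩
  · have h0 : chi q 0 = 0 := by simp [chi]
    have h2pi : Complex.log (2 * Real.pi) = (Real.log (2 * Real.pi) : ℂ) := by
      rw [Complex.ofReal_log (by positivity)]
      push_cast
      rfl
    rw [hΨ.fourierCoeffOn_eq hq, h0, sawtoothMellin_zero, h2pi]
    simp only [zero_mul, neg_zero, Complex.exp_zero, mul_one]
    rw [integral_exponential_sub_chord_zero hq]
    push_cast
    field_simp
    ring
  · intro k hk
    have hre := chi_re q k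
    have hchi : chi q k ≠ 0 := by
      intro h
      have h' := chi_mul_log hq k
      rw [h, zero_mul] at h'
      have hpi : (Real.pi : ℂ) ≠ 0 := by exact_mod_cast Real.pi_ne_zero
      have hk' : (k : ℂ) ≠ 0 := by exact_mod_cast hk
      exact mul_ne_zero (mul_ne_zero (mul_ne_zero two_ne_zero hpi) Complex.I_ne_zero) hk' h'.symm
    have hchi1 : chi q k ≠ 1 := by
      intro h
      rw [h] at hre
      simp at hre
    have hsub : 1 - chi q k ≠ 0 := sub_ne_zero.2 hchi1.symm
    have hadd : 1 + chi q k ≠ 0 := by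
      intro h
      have := congrArg Complex.re h
      simp [hre] at this
    have hadd' : chi q k + 1 ≠ 0 := by rwa [add_comm]
    have hfac : (Real.log q : ℂ) + -(chi q k * (Real.log q : ℂ)) =
        (1 - chi q k) * (Real.log q : ℂ) := by ring
    rw [hΨ.fourierCoeffOn_eq hq, integral_exponential_sub_chord hq
      (neg_ne_zero.2 (mul_ne_zero hchi hlogC)) (by rw [hfac]; exact mul_ne_zero hsub hlogC)
      (exp_chi_mul_log hq k), sawtoothMellin_eq_riemannZeta (by rw [hre]; norm_num) hchi hchi1,
      hfac]
    -- The elementary integral is (q-1)/(2 s (1-s) log q), which cancels the rational term of M(s).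
    generalize chi q k = s at *
    field_simp
    ring
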